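/- Let $R$ be a commutative Noetherian ring, $I$ a proper ideal of $R$, and $n\ge 0$ an integer. For a commutative Noetherian ring $A$, an ideal $J$ of $A$ and a finitely generated $A$-module $M$ with $JM\neq M$, let $\operatorname{grade}(J,M)$ be the supremum of the lengths of the $M$-regular sequences contained in $J$ (equivalently, the common length of the maximal ones), and say that $M$ is $J$-Cohen Macaulay if $$\operatorname{grade}(J,M)+\dim_A(M/JM)=\dim_A(M),$$ an equality in $\mathbb{N}\cup\{\infty\}$. Let $I[x_1,\dots,x_n]$ and $I[[x_1,\dots,x_n]]$ be the ideals of $R[x_1,\dots,x_n]$ and $R[[x_1,\dots,x_n]]$ consisting of the polynomials, respectively the formal power series, all of whose coefficients lie in $I$. Then the following conditions are equivalent: 1. $R$ is $I$-Cohen Macaulay (as a module over itself); 2. $R[x_1,\dots,x_n]$ is $I[x_1,\dots,x_n]$-Cohen Macaulay (as a module over itself) and $\operatorname{grade}(I[x_1,\dots,x_n],R[x_1,\dots,x_n])=\operatorname{grade}(I,R)$; 3. $R[[x_1,\dots,x_n]]$ is $I[[x_1,\dots,x_n]]$-Cohen Macaulay (as a module over itself) and $\operatorname{grade}(I[[x_1,\dots,x_n]],R[[x_1,\dots,x_n]])=\operatorname{grade}(I,R)$.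 -/

import Mathlib

universe u v

/-- The grade of an ideal `I` on a module `M`: the supremum of the lengths of the `M`-regular
sequences contained in `I` if `I M ≠ M`, and `∞` if `I M = M` (the usual convention). For a finitely
generated module over a Noetherian ring with `I M ≠ M`, all maximal `M`-regular sequences in `I`
have the same finite length, which is this supremum. -/
noncomputable def idealGrade {R : Type u} [CommRing R] (I : Ideal R)
    (M : Type v) [AddCommGroup M] [Module R M] : ℕ∞ :=
  open Classical in
  if (I • ⊤ : Submodule R M) = ⊤ then ⊤
  else ⨆ (rs : List R) (_ : RingTheory.Sequence.IsRegular M rs) (_ : ∀ r ∈ rs, r ∈ I),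
    (rs.length : ℕ∞)

/-- A finitely generated module `M` over a Noetherian ring `R` is `I`-Cohen Macaulay if
`grade(I, M) + dim (M / I M) = dim M`. The dimension of a module is the Krull dimension of its
support; the equality is one of extended natural numbers (with `-∞` for the zero module). -/
def IsIdealCohenMacaulay {R : Type u} [CommRing R] [IsNoetherianRing R] (I : Ideal R)
    (M : Type v) [AddCommGroup M] [Module R M] [Module.Finite R M] : Prop :=
  (idealGrade I M : WithBot ℕ∞) + Module.supportDim R (M ⧸ (I • ⊤ : Submodule R M)) =
    Module.supportDim R M

/-- `I[x₁, …, xₙ]`: the ideal of the polynomials all of whose coefficients lie in `I`. -/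
def polynomialIdeal {R : Type u} [CommRing R] (I : Ideal R) (n : ℕ) :
    Ideal (MvPolynomial (Fin n) R) where
  carrier := {f | ∀ m : Fin n →₀ ℕ, MvPolynomial.coeff m f ∈ I}
  zero_mem' := fun m => by simp
  add_mem' := fun {f g} hf hg m => by
    rw [MvPolynomial.coeff_add]
    exact I.add_mem (hf m) (hg m)
  smul_mem' := fun f g hg m => by
    classical
    rw [smul_eq_mul, MvPolynomial.coeff_mul]
    exact Ideal.sum_mem I fun p _ => I.mul_mem_left _ (hg p.2)

/-- `I[[x₁, …, xₙ]]`: the ideal of the formal power series all of whose coefficients lie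
in `I`. -/
def powerSeriesIdeal {R : Type u} [CommRing R] (I : Ideal R) (n : ℕ) :
    Ideal (MvPowerSeries (Fin n) R) where
  carrier := {f | ∀ m : Fin n →₀ ℕ, MvPowerSeries.coeff m f ∈ I}
  zero_mem' := fun m => by simp
  add_mem' := fun {f g} hf hg m => by
    rw [map_add]
    exact I.add_mem (hf m) (hg m)
  smul_mem' := fun f g hg m => by
    classical
    rw [smul_eq_mul, MvPowerSeries.coeff_mul]
    exact Ideal.sum_mem I fun p _ => I.mul_mem_left _ (hg p.2)

/-! Let `S` be the polynomial or the power series ring. It is Noetherian and faithfully flat over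
`R`, and the ideal in question is `IS`. Grade is unchanged by such an extension
(`idealGrade_map_of_faithfullyFlat`), so the grade clauses in 2 and 3 hold automatically. Since `S ⧸
IS` is the same construction over `R ⧸ I`, both dimensions grow by `n`, and the finite `n` cancels.

For the grade, flatness carries regular sequences up. Conversely, if `xs` in `I` cannot be extended,
some `u ∉ (xs)` has `Iu ⊆ (xs)`. Then `u` obstructs extending `xs` inside `IS`, so no regular
sequence in `IS` is longer. -/

open RingTheory.Sequence CategoryTheory Abelian Pointwise

/-! ### Grade and faithfully flat extensions. -/

section Grade

/-- As `r ∈ I`, the preimage of `I(M/rM)` in `M` is `IM + rM = IM`. -/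
lemma ideal_smul_top_quotSMulTop_ne_top {R M : Type*} [CommRing R] [AddCommGroup M] [Module R M]
    {I : Ideal R} {r : R} (hr : r ∈ I) (hI : I • (⊤ : Submodule R M) ≠ ⊤) :
    I • (⊤ : Submodule R (QuotSMulTop r M)) ≠ ⊤ := by
  by_contra eq
  absurd congrArg (Submodule.comap (Submodule.mkQ _)) eq
  simpa [Submodule.comap_smul_top_of_surjective I _ (Submodule.mkQ_surjective _),
    Submodule.smul_mono_left ((Ideal.span_singleton_le_iff_mem I).mpr hr),
    ← Submodule.ideal_span_singleton_smul] using hI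

/-- If `I` contains an `M`-regular sequence of length `n + 1`, then it contains an `M / xM`-regular
sequence of length `n` for every `M`-regular element `x` of `I`. -/
lemma exists_isRegular_quotSMulTop {R : Type u} [CommRing R] [IsNoetherianRing R] {I : Ideal R}
    {M : Type u} [AddCommGroup M] [Module R M] [Module.Finite R M]
    (hI : I • (⊤ : Submodule R M) ≠ ⊤) {x : R} (hx : x ∈ I) (hreg : IsSMulRegular M x) {n : ℕ}
    (h : ∃ rs : List R, rs.length = n + 1 ∧ (∀ r ∈ rs, r ∈ I) ∧ IsRegular M rs) :
    ∃ rs : List R, rs.length = n ∧ (∀ r ∈ rs, r ∈ I) ∧ IsRegular (QuotSMulTop x M) rs := by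
  obtain ⟨rs, hlen, hmem, hrs⟩ := h
  let N : ModuleCat.{u} R := ModuleCat.of R (R ⧸ I)
  have hN : Module.support R N = PrimeSpectrum.zeroLocus I := by
    change Module.support R (R ⧸ I) = _
    rw [Module.support_eq_zeroLocus, Ideal.annihilator_quotient]
  -- Regular sequences of length `k` in `I` exist iff `Ext^i(R/I, M) = 0` for all `i < k`. The long
  -- exact sequence of `0 → M → M → M/xM → 0` puts `Ext^i(R/I, M/xM)` between `Ext^i(R/I, M)` and
  -- `Ext^(i+1)(R/I, M)`, at the cost of one degree.
  have hExt := ModuleCat.subsingleton_ext_of_exists_isRegular I N hN.subset (ModuleCat.of R M)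
    hI.lt_top rs hmem hrs
  refine ModuleCat.exists_isRegular_of_exists_subsingleton_ext I n
    (ModuleCat.of R (QuotSMulTop x M)) (ideal_smul_top_quotSMulTop_ne_top hx hI).lt_top N hN ?_
  intro i hi
  have zero1 := AddCommGrpCat.isZero_of_iff_subsingleton.mpr (hExt i (by omega))
  have zero2 := AddCommGrpCat.isZero_of_iff_subsingleton.mpr (hExt (i + 1) (by omega))
  have hreg' : IsSMulRegular (ModuleCat.of R M) x := hreg
  exact AddCommGrpCat.subsingleton_of_isZero <| ShortComplex.Exact.isZero_of_both_zeros
    ((Ext.covariant_sequence_exact₃' N hreg'.smulShortComplex_shortExact) i (i + 1) rfl)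
    (zero1.eq_zero_of_src _) (zero2.eq_zero_of_tgt _)

/-- An `M`-regular sequence in `I` that is shorter than some other one is not maximal. -/
lemma exists_isSMulRegular_quotient_of_isRegular {R : Type u} [CommRing R] [IsNoetherianRing R]
    {I : Ideal R} {xs : List R} {M : Type u} [AddCommGroup M] [Module R M] [Module.Finite R M]
    (hI : I • (⊤ : Submodule R M) ≠ ⊤) (hxs : ∀ r ∈ xs, r ∈ I) (hreg : IsWeaklyRegular M xs)
    (h : ∃ rs : List R, rs.length = xs.length + 1 ∧ (∀ r ∈ rs, r ∈ I) ∧ IsRegular M rs) :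
    ∃ z ∈ I, IsSMulRegular (M ⧸ (Ideal.ofList xs • ⊤ : Submodule R M)) z := by
  induction xs generalizing M with
  | nil =>
    obtain ⟨rs, hlen, hmem, hrs⟩ := h
    obtain ⟨z, rfl⟩ := List.length_eq_one_iff.mp hlen
    refine ⟨z, hmem z (by simp), ?_⟩
    have e : (M ⧸ (Ideal.ofList ([] : List R) • ⊤ : Submodule R M)) ≃ₗ[R] M :=
      Submodule.quotEquivOfEqBot _ (by rw [Ideal.ofList_nil, Submodule.bot_smul])
    exact (e.isSMulRegular_congr z).mpr ((isWeaklyRegular_singleton_iff M z).mp hrs.1)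
  | cons x xs ih =>
    rw [isWeaklyRegular_cons_iff] at hreg
    have hx : x ∈ I := hxs x List.mem_cons_self
    obtain ⟨z, hz, hz'⟩ := ih (M := QuotSMulTop x M) (ideal_smul_top_quotSMulTop_ne_top hx hI)
      (fun r hr => hxs r (List.mem_cons_of_mem _ hr)) hreg.2
      (exists_isRegular_quotSMulTop hI hx hreg.1 h)
    exact ⟨z, hz, ((Submodule.quotOfListConsSMulTopEquivQuotSMulTopInner M x xs).isSMulRegular_congr
      z).mpr hz'⟩

lemma isRegular_take {R M : Type*} [CommRing R] [AddCommGroup M] [Module R M] {rs : List R}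
    (h : IsRegular M rs) (n : ℕ) : IsRegular M (rs.take n) := by
  have hw : IsWeaklyRegular M (rs.take n ++ rs.drop n) := by
    rw [List.take_append_drop]; exact h.1
  refine ⟨((isWeaklyRegular_append_iff M _ _).mp hw).1, fun heq => h.2 ?_⟩
  refine (top_le_iff.mp (heq.le.trans (Submodule.smul_mono_left ?_))).symm
  exact Ideal.span_mono fun r hr => List.mem_of_mem_take hr

lemma ofList_smul_top_self {R : Type*} [CommRing R] (xs : List R) :
    (Ideal.ofList xs • ⊤ : Submodule R R) = Ideal.ofList xs := by
  rw [smul_eq_mul, Ideal.mul_top]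

/-- A regular sequence in `I` that remains shorter than some regular sequence in `IS`, for a
faithfully flat `R`-algebra `S`, extends to a longer regular sequence in `I`. -/
lemma exists_isRegular_concat_of_faithfullyFlat {R S : Type u} [CommRing R] [CommRing S]
    [Algebra R S] [IsNoetherianRing R] [IsNoetherianRing S] [Module.FaithfullyFlat R S]
    {I : Ideal R} (hI : I ≠ ⊤) {xs : List R} (hxs : ∀ r ∈ xs, r ∈ I) (hreg : IsRegular R xs)
    {ys : List S} (hys : ∀ s ∈ ys, s ∈ I.map (algebraMap R S)) (hyreg : IsRegular S ys)
    (hlen : xs.length < ys.length) :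
    ∃ z ∈ I, IsRegular R (xs ++ [z]) := by
  set J := I.map (algebraMap R S)
  have hJ : J ≠ ⊤ := fun h => hI <| by
    rw [← Ideal.comap_map_eq_self_of_faithfullyFlat (B := S) I,
      show I.map (algebraMap R S) = ⊤ from h, Ideal.comap_top]
  suffices h : ∃ z ∈ I, IsSMulRegular (R ⧸ (Ideal.ofList xs • ⊤ : Submodule R R)) z by
    obtain ⟨z, hz, hzreg⟩ := h
    refine ⟨z, hz, ⟨(isWeaklyRegular_append_iff _ _ _).mpr
      ⟨hreg.1, (isWeaklyRegular_singleton_iff _ _).mpr hzreg⟩, fun heq => hI ?_⟩⟩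
    rw [ofList_smul_top_self] at heq
    refine top_le_iff.mp (heq.le.trans (Ideal.span_le.mpr fun r hr => ?_))
    rcases List.mem_append.mp hr with hr | hr
    · exact hxs r hr
    · exact List.mem_singleton.mp hr ▸ hz
  -- If no element of `I` is regular on `R/(xs)`, there is a nonzero map `R/I → R/(xs)`; the image
  -- of `1` lifts to the obstruction `u`.
  by_contra hno
  have hns : ¬ Subsingleton ((R ⧸ I) →ₗ[R] (R ⧸ (Ideal.ofList xs • ⊤ : Submodule R R))) := by
    rw [IsSMulRegular.subsingleton_linearMap_iff, Ideal.annihilator_quotient]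
    exact hno
  rw [not_subsingleton_iff_nontrivial] at hns
  obtain ⟨f, hf⟩ := exists_ne (0 : (R ⧸ I) →ₗ[R] (R ⧸ (Ideal.ofList xs • ⊤ : Submodule R R)))
  obtain ⟨u, hu⟩ := Submodule.mkQ_surjective _ (f (Ideal.Quotient.mk I 1))
  have hu0 : u ∉ Ideal.ofList xs := by
    intro hmem
    rw [← ofList_smul_top_self, ← Submodule.Quotient.mk_eq_zero, ← Submodule.mkQ_apply, hu] at hmem
    refine hf (LinearMap.ext fun q => ?_)
    obtain ⟨r, rfl⟩ := Ideal.Quotient.mk_surjective q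
    have : Ideal.Quotient.mk I r = r • Ideal.Quotient.mk I 1 := by
      rw [← Ideal.Quotient.mk_eq_mk, ← Ideal.Quotient.mk_eq_mk, ← Submodule.Quotient.mk_smul,
        smul_eq_mul, mul_one]
    rw [this, map_smul, hmem, smul_zero, LinearMap.zero_apply]
  have hIu : ∀ r ∈ I, r * u ∈ Ideal.ofList xs := by
    intro r hr
    have hr1 : r • Ideal.Quotient.mk I 1 = 0 := by
      rw [← Ideal.Quotient.mk_eq_mk, ← Submodule.Quotient.mk_smul, smul_eq_mul, mul_one]
      exact (Submodule.Quotient.mk_eq_zero _).mpr hr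
    rw [← ofList_smul_top_self, ← smul_eq_mul, ← Submodule.Quotient.mk_eq_zero,
      ← Submodule.mkQ_apply, map_smul, hu, ← map_smul, hr1, map_zero]
  have hJu : ∀ s ∈ J, s * algebraMap R S u ∈ Ideal.ofList (xs.map (algebraMap R S)) := by
    intro s hs
    rw [← Ideal.map_ofList]
    have hle : J * Ideal.span {algebraMap R S u} ≤ (Ideal.ofList xs).map (algebraMap R S) := by
      rw [← Set.image_singleton, ← Ideal.map_span, ← Ideal.map_mul]
      refine Ideal.map_mono (Ideal.mul_le.mpr fun r hr v hv => ?_)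
      obtain ⟨a, rfl⟩ := Ideal.mem_span_singleton'.mp hv
      rw [mul_left_comm]
      exact Ideal.mul_mem_left _ _ (hIu r hr)
    exact hle (Ideal.mul_mem_mul hs (Ideal.mem_span_singleton_self _))
  -- The image of `xs` is weakly regular by flatness, and `ys` is cut to exactly one element more.
  -- The resulting `z` kills `u` in `S/(xs)S`, so `u ∈ (xs)S ∩ R = (xs)`.
  obtain ⟨z, hz, hzreg⟩ := exists_isSMulRegular_quotient_of_isRegular (I := J) (M := S)
    (xs := xs.map (algebraMap R S)) (by rwa [smul_eq_mul, Ideal.mul_top])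
    (fun s hs => by
      obtain ⟨r, hr, rfl⟩ := List.mem_map.mp hs
      exact Ideal.mem_map_of_mem _ (hxs r hr))
    hreg.1.of_flat
    ⟨ys.take (xs.length + 1), by simp; omega, fun s hs => hys s (List.mem_of_mem_take hs),
      isRegular_take hyreg _⟩
  have hzu : (Submodule.Quotient.mk (algebraMap R S u) :
      S ⧸ (Ideal.ofList (xs.map (algebraMap R S)) • ⊤ : Submodule S S)) = 0 := by
    apply hzreg
    change z • (Submodule.Quotient.mk (algebraMap R S u) :
      S ⧸ (Ideal.ofList (xs.map (algebraMap R S)) • ⊤ : Submodule S S)) = z • 0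
    rw [smul_zero, ← Submodule.Quotient.mk_smul, Submodule.Quotient.mk_eq_zero,
      ofList_smul_top_self, smul_eq_mul]
    exact hJu z hz
  rw [Submodule.Quotient.mk_eq_zero, ofList_smul_top_self, ← Ideal.map_ofList] at hzu
  exact hu0 (by
    rw [← Ideal.comap_map_eq_self_of_faithfullyFlat (B := S) (Ideal.ofList xs)]
    exact hzu)

/-- Grade is invariant under faithfully flat extensions of Noetherian rings. -/
theorem idealGrade_map_of_faithfullyFlat {R S : Type u} [CommRing R] [CommRing S] [Algebra R S]
    [IsNoetherianRing R] [IsNoetherianRing S] [Module.FaithfullyFlat R S] {I : Ideal R}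
    (hI : I ≠ ⊤) : idealGrade (I.map (algebraMap R S)) S = idealGrade I R := by
  have hJ : I.map (algebraMap R S) ≠ ⊤ := fun h => hI <| by
    rw [← Ideal.comap_map_eq_self_of_faithfullyFlat (B := S) I, h, Ideal.comap_top]
  have : Nontrivial R := Submodule.nontrivial_iff R |>.mp (nontrivial_of_ne I ⊤ hI)
  rw [idealGrade, idealGrade, if_neg (by rwa [smul_eq_mul, Ideal.mul_top]),
    if_neg (by rwa [smul_eq_mul, Ideal.mul_top])]
  refine le_antisymm (iSup_le fun ys => iSup_le fun hyreg => iSup_le fun hys => ?_)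
    (iSup_le fun xs => iSup_le fun hreg => iSup_le fun hxs => ?_)
  -- A regular sequence in `I` is grown one element at a time up to the length of `ys`.
  · have key : ∀ k ≤ ys.length, ∃ xs : List R, xs.length = k ∧ (∀ r ∈ xs, r ∈ I) ∧
        IsRegular R xs := by
      intro k
      induction k with
      | zero => exact fun _ => ⟨[], rfl, by simp, IsRegular.nil R R⟩
      | succ k ih =>
        intro hk
        obtain ⟨xs, hlen, hxs, hreg⟩ := ih (by omega)
        obtain ⟨z, hz, hzreg⟩ := exists_isRegular_concat_of_faithfullyFlat hI hxs hreg hys hyreg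
          (by omega)
        refine ⟨xs ++ [z], by simp [hlen], fun r hr => ?_, hzreg⟩
        rcases List.mem_append.mp hr with hr | hr
        · exact hxs r hr
        · exact List.mem_singleton.mp hr ▸ hz
    obtain ⟨xs, hlen, hxs, hreg⟩ := key ys.length le_rfl
    rw [← hlen]
    exact le_iSup_of_le xs (le_iSup_of_le hreg (le_iSup_of_le hxs le_rfl))
  · refine le_iSup_of_le (xs.map (algebraMap R S)) (le_iSup_of_le hreg.of_faithfullyFlat
      (le_iSup_of_le (fun s hs => ?_) (by simp)))
    obtain ⟨r, hr, rfl⟩ := List.mem_map.mp hs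
    exact Ideal.mem_map_of_mem _ (hxs r hr)

end Grade

/-! ### Power series: faithful flatness, extended ideals, dimension. -/

section PowerSeries

/-- Direct powers of a Noetherian ring are flat. -/
theorem flat_pi_of_isNoetherianRing (R ι : Type*) [CommRing R] [IsNoetherianRing R] :
    Module.Flat R (ι → R) := by
  refine Module.Flat.of_forall_isTrivialRelation fun {l f x} h => ?_
  let φ : (Fin l → R) →ₗ[R] R := Fintype.linearCombination R f
  -- A relation over `ι → R` is a family of relations over `R`, all combinations of one finite
  -- generating set of syzygies of `f`; this is the equational criterion for flatness.
  obtain ⟨m, k, hk⟩ := Submodule.fg_iff_exists_fin_generating_family.mp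
    (IsNoetherian.noetherian (LinearMap.ker φ))
  have hx : ∀ d, ∃ c : Fin m → R, ∑ j, c j • k j = fun i => x i d := by
    intro d
    rw [← Submodule.mem_span_range_iff_exists_fun, hk, LinearMap.mem_ker]
    simpa [φ, Fintype.linearCombination_apply, mul_comm] using congrFun h d
  choose c hc using hx
  refine ⟨m, fun i j => k j i, fun j d => c d j, fun i => ?_, fun j => ?_⟩
  · funext d
    rw [← congrFun (hc d) i]
    simp [mul_comm]
  · have hj : k j ∈ LinearMap.ker φ := hk ▸ Submodule.subset_span ⟨j, rfl⟩
    simpa [φ, Fintype.linearCombination_apply, mul_comm] using LinearMap.mem_ker.mp hj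

/-- As a module this is a direct power of `R`. The constant coefficient sends `m • ⊤` into `m`, so
`1 ∈ m • ⊤` would force `1 ∈ m`. -/
instance faithfullyFlat_mvPowerSeries (R σ : Type*) [CommRing R] [IsNoetherianRing R] :
    Module.FaithfullyFlat R (MvPowerSeries σ R) where
  toFlat := flat_pi_of_isNoetherianRing R (σ →₀ ℕ)
  submodule_ne_top m hm h := by
    refine hm.ne_top ((Ideal.eq_top_iff_one m).mpr ?_)
    have h1 : (1 : MvPowerSeries σ R) ∈ (m • ⊤ : Submodule R (MvPowerSeries σ R)) := by
      rw [h]; trivial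
    have h2 := Submodule.mem_map_of_mem (f := MvPowerSeries.coeff (R := R) (0 : σ →₀ ℕ)) h1
    rw [Submodule.map_smul''] at h2
    have h3 := (smul_mono_right m (le_top : _ ≤ (⊤ : Submodule R R)) :) h2
    simpa using h3

lemma ker_mvPowerSeries_map_mk {R : Type u} [CommRing R] (I : Ideal R) (n : ℕ) :
    RingHom.ker (MvPowerSeries.map (σ := Fin n) (Ideal.Quotient.mk I)) = powerSeriesIdeal I n := by
  ext f
  rw [RingHom.mem_ker, MvPowerSeries.ext_iff]
  simp only [MvPowerSeries.coeff_map, map_zero, Ideal.Quotient.eq_zero_iff_mem]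
  rfl

/-- Finite generation of `I` is essential: writing every coefficient in the same finitely many
generators turns the multipliers into finitely many power series. -/
lemma powerSeriesIdeal_eq_map {R : Type u} [CommRing R] [IsNoetherianRing R] (I : Ideal R)
    (n : ℕ) : powerSeriesIdeal I n = I.map (algebraMap R (MvPowerSeries (Fin n) R)) := by
  refine le_antisymm (fun f hf => ?_) (Ideal.map_le_iff_le_comap.mpr fun r hr m => ?_)
  · obtain ⟨k, a, ha⟩ := Submodule.fg_iff_exists_fin_generating_family.mp
      (IsNoetherian.noetherian I)
    have h : ∀ m, ∃ c : Fin k → R, ∑ j, c j • a j = MvPowerSeries.coeff m f := fun m =>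
      Submodule.mem_span_range_iff_exists_fun R |>.mp (ha ▸ hf m)
    choose c hc using h
    have hf' : f = ∑ j, (show MvPowerSeries (Fin n) R from fun m => c m j) *
        algebraMap R (MvPowerSeries (Fin n) R) (a j) := by
      ext m
      rw [map_sum, ← hc m]
      refine Finset.sum_congr rfl fun j _ => ?_
      rw [mul_comm, ← Algebra.smul_def, map_smul, smul_eq_mul, smul_eq_mul, mul_comm]
      rfl
    rw [hf']
    refine Ideal.sum_mem _ fun j _ => Ideal.mul_mem_left _ _ (Ideal.mem_map_of_mem _ ?_)
    exact ha ▸ Submodule.subset_span ⟨j, rfl⟩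
  · classical
    rw [MvPowerSeries.algebraMap_apply, Algebra.algebraMap_self, RingHom.id_apply,
      MvPowerSeries.coeff_C]
    split_ifs
    exacts [hr, I.zero_mem]

/-- `X` is a nonzerodivisor in the Jacobson radical, so killing it lowers the dimension by exactly
one, and the quotient is `R`. -/
theorem ringKrullDim_powerSeries (R : Type*) [CommRing R] [IsNoetherianRing R] :
    ringKrullDim (PowerSeries R) = ringKrullDim R + 1 := by
  have hX : (PowerSeries.X : PowerSeries R) ∈ Ring.jacobson (PowerSeries R) := by
    rw [← Ideal.jacobson_bot, Ideal.mem_jacobson_bot]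
    intro y
    rw [PowerSeries.isUnit_iff_constantCoeff]
    simp
  have hreg : IsSMulRegular (PowerSeries R) (PowerSeries.X : PowerSeries R) :=
    PowerSeries.X_mul_injective
  have hker : Ideal.span {PowerSeries.X} = RingHom.ker (PowerSeries.constantCoeff (R := R)) := by
    ext f
    rw [Ideal.mem_span_singleton, PowerSeries.X_dvd_iff, RingHom.mem_ker]
  rw [← ringKrullDim_quotient_span_singleton_succ_eq_ringKrullDim_of_mem_jacobson hreg hX,
    ringKrullDim_eq_of_ringEquiv ((Ideal.quotEquivOfEq hker).trans
      (RingHom.quotientKerEquivOfSurjective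
        (f := PowerSeries.constantCoeff (R := R)) PowerSeries.constantCoeff_surj))]

theorem ringKrullDim_mvPowerSeries_fin (R : Type*) [CommRing R] [IsNoetherianRing R] (n : ℕ) :
    ringKrullDim (MvPowerSeries (Fin n) R) = ringKrullDim R + n := by
  induction n with
  | zero =>
    simpa using ringKrullDim_eq_of_ringEquiv (MvPowerSeries.isEmptyEquiv (Fin 0) R).toRingEquiv
  | succ n ih =>
    rw [ringKrullDim_eq_of_ringEquiv (MvPowerSeries.finSuccEquiv R n).toRingEquiv,
      ringKrullDim_powerSeries, ih, Nat.cast_succ, add_assoc]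

lemma ringKrullDim_quotient_powerSeriesIdeal {R : Type u} [CommRing R] [IsNoetherianRing R]
    (I : Ideal R) (n : ℕ) :
    ringKrullDim (MvPowerSeries (Fin n) R ⧸ powerSeriesIdeal I n) = ringKrullDim (R ⧸ I) + n := by
  have hsurj : Function.Surjective (MvPowerSeries.map (σ := Fin n) (Ideal.Quotient.mk I)) :=
    fun g => ⟨fun m => (Ideal.Quotient.mk_surjective (g m)).choose,
      funext fun m => (Ideal.Quotient.mk_surjective (g m)).choose_spec⟩
  rw [ringKrullDim_eq_of_ringEquiv ((Ideal.quotEquivOfEq (ker_mvPowerSeries_map_mk I n).symm).trans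
    (RingHom.quotientKerEquivOfSurjective hsurj)), ringKrullDim_mvPowerSeries_fin]

end PowerSeries

/-! ### Polynomials: extended ideals and dimension. -/

section Polynomial

lemma polynomialIdeal_eq_map {R : Type u} [CommRing R] (I : Ideal R) (n : ℕ) :
    polynomialIdeal I n = I.map (algebraMap R (MvPolynomial (Fin n) R)) :=
  Ideal.ext fun _ => MvPolynomial.mem_map_C_iff.symm

lemma ringKrullDim_quotient_polynomialIdeal {R : Type u} [CommRing R] [IsNoetherianRing R]
    (I : Ideal R) (n : ℕ) :
    ringKrullDim (MvPolynomial (Fin n) R ⧸ polynomialIdeal I n) = ringKrullDim (R ⧸ I) + n := by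
  rw [ringKrullDim_eq_of_ringEquiv ((Ideal.quotEquivOfEq (polynomialIdeal_eq_map I n)).trans
    (MvPolynomial.quotientEquivQuotientMvPolynomial I).toRingEquiv.symm),
    MvPolynomial.ringKrullDim_of_isNoetherianRing, Nat.card_fin]

end Polynomial

/-! ### Comparing the Cohen Macaulay equalities. -/

lemma isIdealCohenMacaulay_self_iff {R : Type u} [CommRing R] [IsNoetherianRing R] (I : Ideal R) :
    IsIdealCohenMacaulay I R ↔
      (idealGrade I R : WithBot ℕ∞) + ringKrullDim (R ⧸ I) = ringKrullDim R := by
  rw [IsIdealCohenMacaulay, show (I • ⊤ : Submodule R R) = I by rw [smul_eq_mul, Ideal.mul_top],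
    Module.supportDim_quotient_eq_ringKrullDim, Module.supportDim_self_eq_ringKrullDim]

/-- If passing from `(R, I)` to `(S, J)` preserves the grade and raises both dimensions by `n`, it
preserves and reflects the Cohen Macaulay property. -/
lemma isIdealCohenMacaulay_iff_of_ringKrullDim_eq {R S : Type u} [CommRing R] [CommRing S]
    [IsNoetherianRing R] [IsNoetherianRing S] {I : Ideal R} {J : Ideal S} {n : ℕ}
    (hgrade : idealGrade J S = idealGrade I R) (hdim : ringKrullDim S = ringKrullDim R + n)
    (hquot : ringKrullDim (S ⧸ J) = ringKrullDim (R ⧸ I) + n) :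
    IsIdealCohenMacaulay J S ↔ IsIdealCohenMacaulay I R := by
  rw [isIdealCohenMacaulay_self_iff, isIdealCohenMacaulay_self_iff, hgrade, hdim, hquot,
    ← add_assoc]
  refine ⟨fun h => ?_, fun h => by rw [h]⟩
  -- Dimensions may be infinite, but `n` is finite, so it still cancels.
  have hcancel : ∀ a b : WithBot ℕ∞, a + (n : WithBot ℕ∞) = b + n → a = b := by
    intro a b hab
    induction a with
    | bot =>
      induction b with
      | bot => rfl
      | coe b =>
        rw [WithBot.bot_add] at hab
        exact absurd hab.symm (by exact_mod_cast WithBot.coe_ne_bot)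
    | coe a =>
      induction b with
      | bot =>
        rw [WithBot.bot_add] at hab
        exact absurd hab (by exact_mod_cast WithBot.coe_ne_bot)
      | coe b =>
        have hab' : a + (n : ℕ∞) = b + n := by exact_mod_cast hab
        rw [(ENat.add_left_injective_of_ne_top (ENat.natCast_ne_top n)) hab']
  exact hcancel _ _ h

theorem theorem5 {R : Type u} [CommRing R] [IsNoetherianRing R] (I : Ideal R) (hI : I ≠ ⊤)
    (n : ℕ) :
    List.TFAE [
      IsIdealCohenMacaulay I R,
      IsIdealCohenMacaulay (polynomialIdeal I n) (MvPolynomial (Fin n) R) ∧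
        idealGrade (polynomialIdeal I n) (MvPolynomial (Fin n) R) = idealGrade I R,
      IsIdealCohenMacaulay (powerSeriesIdeal I n) (MvPowerSeries (Fin n) R) ∧
        idealGrade (powerSeriesIdeal I n) (MvPowerSeries (Fin n) R) = idealGrade I R] := by
  have : Nontrivial R := Submodule.nontrivial_iff R |>.mp (nontrivial_of_ne I ⊤ hI)
  have hpoly : idealGrade (polynomialIdeal I n) (MvPolynomial (Fin n) R) = idealGrade I R := by
    rw [polynomialIdeal_eq_map]
    exact idealGrade_map_of_faithfullyFlat hI
  have hpow : idealGrade (powerSeriesIdeal I n) (MvPowerSeries (Fin n) R) = idealGrade I R := by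
    rw [powerSeriesIdeal_eq_map]
    exact idealGrade_map_of_faithfullyFlat hI
  tfae_have 2 ↔ 1 := by
    rw [and_iff_left hpoly]
    exact isIdealCohenMacaulay_iff_of_ringKrullDim_eq hpoly
      (by rw [MvPolynomial.ringKrullDim_of_isNoetherianRing, Nat.card_fin])
      (ringKrullDim_quotient_polynomialIdeal I n)
  tfae_have 3 ↔ 1 := by
    rw [and_iff_left hpow]
    exact isIdealCohenMacaulay_iff_of_ringKrullDim_eq hpow (ringKrullDim_mvPowerSeries_fin R n)
      (ringKrullDim_quotient_powerSeriesIdeal I n)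
  tfae_finish
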